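/- Let $n\ge 2$ and let $\diamond^n=\mathrm{conv}\{\pm e_1,\dots,\pm e_n\}\subset\mathbb{R}^n$ be the standard cross-polytope. Let $\varphi:\mathbb{R}^n\to\mathbb{R}$ be a generic linear functional, i.e. one that takes pairwise distinct values at the $2n$ vertices of $\diamond^n$ (equivalently, the numbers $a_i=\varphi(e_i)$ are nonzero and have pairwise distinct absolute values). Let $$MPP_\varphi(\diamond^n)=\mathrm{conv}\Big\{\int_{\varphi(\diamond^n)}s(x)\,dx \;:\; s:\varphi(\diamond^n)\to\diamond^n \text{ continuous},\ \varphi\circ s=\mathrm{id}\Big\}$$ be its monotone path polytope. Then $MPP_\varphi(\diamond^n)$ has exactly $3^{n-1}-1$ vertices. Moreover, these vertices are in bijection with the nonzero sign vectors in $\{-1,0,1\}^{n-1}$, as follows. A monotone path is a sequence of vertices of $\diamond^n$ from the $\varphi$-minimal to the $\varphi$-maximal vertex in which consecutive vertices span an edge of $\diamond^n$ along which $\varphi$ increases; it is traversed by exactly one section $s$ of $\varphi$, whose integral $\int_{\varphi(\diamond^n)} s(x)\,dx$ we call the integral of the path. Let $m$ be the index for which $|a_m|$ is largest, and index the coordinates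 of $\{-1,0,1\}^{n-1}$ by $[n]\setminus\{m\}$. Every vertex $v$ of $MPP_\varphi(\diamond^n)$ is the integral of exactly one monotone path $L_v$. The path $L_v$ contains at most one of $e_i,-e_i$ for each $i\ne m$, and the map $v\mapsto\sigma$, where $\sigma_i=1$ if $e_i\in L_v$, $\sigma_i=-1$ if $-e_i\in L_v$, and $\sigma_i=0$ otherwise, is a bijection from the set of vertices of $MPP_\varphi(\diamond^n)$ onto $\{-1,0,1\}^{[n]\setminus\{m\}}\setminus\{\mathbf 0\}$. -/

import Mathlib

/-- `s` is a (continuous) section over `φ(P)` of the projection `φ : P → φ(P)`. -/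
def IsSection {E : Type*} [NormedAddCommGroup E] [NormedSpace ℝ E]
    (φ : E →ₗ[ℝ] ℝ) (P : Set E) (s : ℝ → E) : Prop :=
  ContinuousOn s (φ '' P) ∧ ∀ x ∈ φ '' P, s x ∈ P ∧ φ (s x) = x

/-- The monotone path polytope: the convex hull of the integrals over `φ(P)` of all
sections of `φ : P → φ(P)`. -/
noncomputable def monotonePathPolytope {E : Type*} [NormedAddCommGroup E] [NormedSpace ℝ E]
    (φ : E →ₗ[ℝ] ℝ) (P : Set E) : Set E :=
  convexHull ℝ {y | ∃ s : ℝ → E, IsSection φ P s ∧ y = ∫ x in φ '' P, s x}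

/-- A `φ`-monotone path on `P`, given by its list of vertices: it starts at a vertex minimizing
`φ`, ends at a vertex maximizing `φ`, and any two consecutive vertices span an edge of `P`
(a one-dimensional face) along which `φ` increases. -/
structure IsMonotonePath {E : Type*} [NormedAddCommGroup E] [NormedSpace ℝ E]
    (φ : E →ₗ[ℝ] ℝ) (P : Set E) (L : List E) : Prop where
  vertices : ∀ p ∈ L, p ∈ P.extremePoints ℝ
  start : ∃ p ∈ L.head?, IsMinOn φ P p
  finish : ∃ p ∈ L.getLast?, IsMaxOn φ P p
  edges : L.IsChain fun p q => φ p < φ q ∧ IsExtreme ℝ P (segment ℝ p q)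

/-- `s` traverses the path `L`: it is a section whose image is the union of the segments joining
consecutive vertices of `L`. -/
def Traverses {E : Type*} [NormedAddCommGroup E] [NormedSpace ℝ E]
    (φ : E →ₗ[ℝ] ℝ) (P : Set E) (s : ℝ → E) (L : List E) : Prop :=
  IsSection φ P s ∧ s '' (φ '' P) = {x | ∃ p q : E, [p, q] <:+: L ∧ x ∈ segment ℝ p q}

/-- `L` is a monotone path on `P` and the integral of the section traversing it is `v`. -/
def IsMonotonePathWithIntegral {E : Type*} [NormedAddCommGroup E] [NormedSpace ℝ E]
    (φ : E →ₗ[ℝ] ℝ) (P : Set E) (L : List E) (v : E) : Prop :=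
  IsMonotonePath φ P L ∧ ∃ s : ℝ → E, Traverses φ P s L ∧ v = ∫ x in φ '' P, s x

/-- `φ` is (vertex) generic on `P`: it takes pairwise distinct values at the vertices of `P`. -/
def IsVertexGeneric {E : Type*} [NormedAddCommGroup E] [NormedSpace ℝ E]
    (φ : E →ₗ[ℝ] ℝ) (P : Set E) : Prop :=
  Set.InjOn φ (P.extremePoints ℝ)

/-- The `i`-th standard basis vector of `ℝⁿ`. -/
def stdVec {n : ℕ} (i : Fin n) : Fin n → ℝ := Pi.single i 1

/-- The standard cross-polytope in `ℝⁿ`, the convex hull of the vectors `± eᵢ`. -/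
def crossPolytope (n : ℕ) : Set (Fin n → ℝ) :=
  convexHull ℝ {v | ∃ i : Fin n, v = stdVec i ∨ v = -stdVec i}

/-! A linear functional `ψ` is maximized over integrals of sections by maximizing it on each fibre
of `φ`, that is, by following the upper boundary of the planar image of the polytope under `(φ, ψ)`.
So the vertices of the monotone path polytope come from the paths that are such an upper boundary,
and the task is to decide which paths these are.

Write `M = |φ eₘ|`. Adding a multiple of `φ` to `ψ` does not change the upper boundary, so `ψ eₘ =
0` may be assumed; the image is then a centrally symmetric polygon with extreme points `(±M, 0)` in
the `φ` direction. Unless `ψ` vanishes, its upper boundary cannot contain two other antipodal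
vertices (`not_neg_mem_upperHull`) and contains some vertex other than `± eₘ`
(`exists_mem_upperHull`). Hence each `ψ` is maximized by the path of a nonzero sign vector
(`exists_signPath_dominating`), and by separation these paths generate the whole polytope.

Conversely, for `σ ≠ 0` there is a functional that lifts the selected vertices onto the parabola `M²
- t²` and keeps all others at height at most 0. Strict concavity makes the path of `σ` the unique
maximizing section (`parabola_dominates`, `signPath_strict`), so its integral is a vertex and no
other path has the same integral (`eq_signPath_of_integral_eq`). -/

section General

variable {E : Type*} [NormedAddCommGroup E] [NormedSpace ℝ E]

/-! ### Linear functionals on convex hulls, and consecutive pairs in lists -/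

theorem le_of_mem_convexHull {V : Set E} (ψ : E →ₗ[ℝ] ℝ) {c : ℝ} (h : ∀ v ∈ V, ψ v ≤ c)
    {x : E} (hx : x ∈ convexHull ℝ V) : ψ x ≤ c :=
  convexHull_min (t := {x | ψ x ≤ c}) h (convex_halfSpace_le ψ.isLinear c) hx

/-- A point of a convex hull maximizing a linear functional lies in the hull of the generators
maximizing it. -/
theorem mem_convexHull_maximizers {V : Set E} (ψ : E →ₗ[ℝ] ℝ) {c : ℝ} (h : ∀ v ∈ V, ψ v ≤ c)
    {x : E} (hx : x ∈ convexHull ℝ V) (hc : ψ x = c) :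
    x ∈ convexHull ℝ {v ∈ V | ψ v = c} := by
  -- The implication is carried along in the set: a combination with positive weights reaches the
  -- bound `c` only if both of its points do.
  have key : Convex ℝ {x | ψ x ≤ c ∧ (ψ x = c → x ∈ convexHull ℝ {v ∈ V | ψ v = c})} := by
    rw [convex_iff_forall_pos]
    rintro x ⟨hx, hx'⟩ y ⟨hy, hy'⟩ a b ha hb hab
    have e : ψ (a • x + b • y) = a * ψ x + b * ψ y := by simp
    have e' : c = a * c + b * c := by rw [← add_mul, hab, one_mul]
    refine ⟨by rw [e]; nlinarith, fun h => ?_⟩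
    rw [e] at h
    have h1 : ψ x = c := by
      by_contra hne
      have := lt_of_le_of_ne hx hne
      nlinarith
    have h2 : ψ y = c := by
      by_contra hne
      have := lt_of_le_of_ne hy hne
      nlinarith
    exact convex_convexHull ℝ _ (hx' h1) (hy' h2) ha.le hb.le hab
  exact (convexHull_min (t := {x | ψ x ≤ c ∧ (ψ x = c → x ∈ convexHull ℝ {v ∈ V | ψ v = c})})
    (fun v hv => ⟨h v hv, fun e => subset_convexHull ℝ _ ⟨hv, e⟩⟩) key hx).2 hc

theorem infix_pair_cons_cons {α : Type*} {p q a b : α} {L : List α} :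
    [a, b] <:+: p :: q :: L ↔ (a = p ∧ b = q) ∨ [a, b] <:+: q :: L := by
  rw [List.infix_cons_iff]
  simp [List.cons_prefix_cons]

theorem not_infix_pair_singleton {α : Type*} {p a b : α} : ¬ [a, b] <:+: [p] := fun h => by
  simpa using h.length_le

theorem exists_infix_pair_of_mem {α : Type*} {v p q : α} {L : List α} (hv : v ∈ p :: q :: L) :
    ∃ a b, [a, b] <:+: p :: q :: L ∧ (v = a ∨ v = b) := by
  induction L generalizing p q with
  | nil => exact ⟨p, q, List.infix_rfl, by simpa using hv⟩
  | cons r L ih =>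
    rcases List.mem_cons.1 hv with rfl | hv
    · exact ⟨v, q, infix_pair_cons_cons.2 (Or.inl ⟨rfl, rfl⟩), Or.inl rfl⟩
    · obtain ⟨a, b, h, h'⟩ := ih hv
      exact ⟨a, b, infix_pair_cons_cons.2 (Or.inr h), h'⟩

/-- Two members of a strictly increasing list that are consecutive have no member between them. -/
theorem pairwise_consecutive {φ : E →ₗ[ℝ] ℝ} {L : List E} (hL : L.Pairwise (φ · < φ ·)) {p q : E}
    (h : [p, q] <:+: L) :
    p ∈ L ∧ q ∈ L ∧ φ p < φ q ∧ ∀ r ∈ L, φ r ≤ φ p ∨ φ q ≤ φ r := by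
  obtain ⟨s, t, rfl⟩ := h
  simp only [List.pairwise_append, List.mem_append, List.mem_cons, List.pairwise_cons,
    List.not_mem_nil, or_false] at hL ⊢
  refine ⟨by simp, by simp, hL.1.2.1.1 q rfl, ?_⟩
  rintro r ((hr | rfl | rfl) | hr)
  · exact Or.inl (hL.1.2.2 r hr p (Or.inl rfl)).le
  · exact Or.inl le_rfl
  · exact Or.inr le_rfl
  · exact Or.inr (hL.2.2 q (Or.inr (Or.inr rfl)) r hr).le

/-! ### Sections traversing polygonal paths -/

/-- The piecewise linear curve through the points of a list, parametrized by `φ`. -/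
noncomputable def polyline (φ : E →ₗ[ℝ] ℝ) : List E → ℝ → E
  | [], _ => 0
  | [p], _ => p
  | p :: q :: L, x =>
    if x ≤ φ q then AffineMap.lineMap p q ((x - φ p) / (φ q - φ p)) else polyline φ (q :: L) x

theorem polyline_head {φ : E →ₗ[ℝ] ℝ} {p : E} {L : List E}
    (hL : (p :: L).IsChain (φ · < φ ·)) : polyline φ (p :: L) (φ p) = p := by
  cases L with
  | nil => rfl
  | cons q L =>
    have : φ p < φ q := (List.isChain_cons_cons.1 hL).1
    simp [polyline, this.le]

theorem continuous_polyline {φ : E →ₗ[ℝ] ℝ} {L : List E} (hL : L.IsChain (φ · < φ ·)) :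
    Continuous (polyline φ L) := by
  induction L with
  | nil => exact continuous_const
  | cons p L ih =>
    cases L with
    | nil => exact continuous_const
    | cons q L =>
      obtain ⟨h, hL'⟩ := List.isChain_cons_cons.1 hL
      have hne : φ q - φ p ≠ 0 := (sub_pos.2 h).ne'
      refine Continuous.if_le (f' := fun x => AffineMap.lineMap p q ((x - φ p) / (φ q - φ p)))
        ?_ (ih hL') continuous_id continuous_const ?_
      · simp only [AffineMap.lineMap_apply_module]
        fun_prop
      · rintro x rfl
        rw [polyline_head hL', div_self hne, AffineMap.lineMap_apply_one]

theorem map_lineMap_div {φ : E →ₗ[ℝ] ℝ} {p q : E} (h : φ p < φ q) (x : ℝ) :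
    φ (AffineMap.lineMap p q ((x - φ p) / (φ q - φ p))) = x := by
  have hne : φ q - φ p ≠ 0 := (sub_pos.2 h).ne'
  simp only [AffineMap.lineMap_apply_module, map_add, map_smul, smul_eq_mul]
  field_simp
  ring

theorem eq_lineMap_div {φ : E →ₗ[ℝ] ℝ} {p q y : E} (h : φ p < φ q) (hy : y ∈ segment ℝ p q) :
    φ p ≤ φ y ∧ φ y ≤ φ q ∧ y = AffineMap.lineMap p q ((φ y - φ p) / (φ q - φ p)) := by
  have hne : 0 < φ q - φ p := sub_pos.2 h
  rw [segment_eq_image_lineMap] at hy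
  obtain ⟨t, ⟨h0, h1⟩, rfl⟩ := hy
  have e : φ (AffineMap.lineMap p q t) = φ p + t * (φ q - φ p) := by
    simp only [AffineMap.lineMap_apply_module, map_add, map_smul, smul_eq_mul]
    ring
  rw [e, add_sub_cancel_left, mul_div_cancel_right₀ _ hne.ne']
  exact ⟨by nlinarith, by nlinarith, rfl⟩

/-- Two points of a segment on which `φ` is not constant agree if they have the same value. -/
theorem eq_of_mem_segment {φ : E →ₗ[ℝ] ℝ} {p q y z : E} (h : φ p < φ q) (hy : y ∈ segment ℝ p q)
    (hz : z ∈ segment ℝ p q) (e : φ y = φ z) : y = z := by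
  rw [(eq_lineMap_div h hy).2.2, (eq_lineMap_div h hz).2.2, e]

theorem polyline_mem {φ : E →ₗ[ℝ] ℝ} {p q : E} {L : List E}
    (hL : (p :: q :: L).IsChain (φ · < φ ·)) {b x : ℝ}
    (hb : ∃ z ∈ (p :: q :: L).getLast?, φ z = b) (hx : φ p ≤ x) (hxb : x ≤ b) :
    φ (polyline φ (p :: q :: L) x) = x ∧
      ∃ a b, [a, b] <:+: p :: q :: L ∧ polyline φ (p :: q :: L) x ∈ segment ℝ a b := by
  induction L generalizing p q with
  | nil =>
    obtain ⟨h, -⟩ := List.isChain_cons_cons.1 hL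
    have hxq : x ≤ φ q := by
      obtain ⟨z, hz, rfl⟩ := hb
      simp at hz
      rwa [hz]
    simp only [polyline, if_pos hxq]
    refine ⟨map_lineMap_div h x, p, q, List.infix_rfl, ?_⟩
    rw [segment_eq_image_lineMap]
    exact ⟨_, ⟨div_nonneg (by linarith) (by linarith), div_le_one_of_le₀ (by linarith)
      (by linarith)⟩, rfl⟩
  | cons r L ih =>
    obtain ⟨h, hL'⟩ := List.isChain_cons_cons.1 hL
    rw [polyline]
    split_ifs with hxq
    · refine ⟨map_lineMap_div h x, p, q, infix_pair_cons_cons.2 (Or.inl ⟨rfl, rfl⟩), ?_⟩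
      rw [segment_eq_image_lineMap]
      exact ⟨_, ⟨div_nonneg (by linarith) (by linarith), div_le_one_of_le₀ (by linarith)
        (by linarith)⟩, rfl⟩
    · obtain ⟨h1, a, b, h2, h3⟩ := ih hL' (by simpa using hb) (not_le.1 hxq).le
      exact ⟨h1, a, b, infix_pair_cons_cons.2 (Or.inr h2), h3⟩

theorem polyline_apply_of_mem {φ : E →ₗ[ℝ] ℝ} {p : E} {L : List E}
    (hL : (p :: L).IsChain (φ · < φ ·)) {a b y : E} (hab : [a, b] <:+: p :: L)
    (hy : y ∈ segment ℝ a b) : φ p ≤ φ y ∧ polyline φ (p :: L) (φ y) = y := by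
  induction L generalizing p with
  | nil => exact (not_infix_pair_singleton hab).elim
  | cons q L ih =>
    obtain ⟨h, hL'⟩ := List.isChain_cons_cons.1 hL
    rcases infix_pair_cons_cons.1 hab with ⟨rfl, rfl⟩ | hab
    · obtain ⟨h1, h2, h3⟩ := eq_lineMap_div h hy
      exact ⟨h1, by rw [polyline, if_pos h2, ← h3]⟩
    · obtain ⟨h1, h2⟩ := ih hL' hab
      refine ⟨h.le.trans h1, ?_⟩
      rw [polyline]
      split_ifs with hle
      · have e : φ y = φ q := le_antisymm hle h1
        rw [e, polyline_head hL'] at h2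
        rw [e, div_self (sub_pos.2 h).ne', AffineMap.lineMap_apply_one, h2]
      · exact h2

/-- The polyline through an increasing list of points of `P` is a section traversing it. -/
theorem traverses_polyline {φ : E →ₗ[ℝ] ℝ} {P : Set E} (hP : Convex ℝ P) {p q : E} {L : List E}
    (hL : (p :: q :: L).IsChain (φ · < φ ·)) (hLP : ∀ v ∈ p :: q :: L, v ∈ P) {b : ℝ}
    (hb : ∃ z ∈ (p :: q :: L).getLast?, φ z = b) (him : φ '' P = Set.Icc (φ p) b) :
    Traverses φ P (polyline φ (p :: q :: L)) (p :: q :: L) := by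
  have sub : ∀ a b, [a, b] <:+: p :: q :: L → segment ℝ a b ⊆ P := fun a b h =>
    hP.segment_subset (hLP _ (h.subset (by simp))) (hLP _ (h.subset (by simp)))
  refine ⟨⟨(continuous_polyline hL).continuousOn, fun x hx => ?_⟩, ?_⟩
  · rw [him] at hx
    obtain ⟨h1, a, b, h2, h3⟩ := polyline_mem hL hb hx.1 hx.2
    exact ⟨sub a b h2 h3, h1⟩
  · ext y
    constructor
    · rintro ⟨x, hx, rfl⟩
      rw [him] at hx
      exact (polyline_mem hL hb hx.1 hx.2).2
    · rintro ⟨a, b, hab, hy⟩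
      exact ⟨φ y, ⟨y, sub a b hab hy, rfl⟩, (polyline_apply_of_mem hL hab hy).2⟩

/-! ### Integrals of sections -/

theorem integrableOn_section {φ : E →ₗ[ℝ] ℝ} {P : Set E} {lo hi : ℝ}
    (him : φ '' P = Set.Icc lo hi) {s : ℝ → E} (hs : IsSection φ P s) :
    MeasureTheory.IntegrableOn s (φ '' P) := by
  have := hs.1
  rw [him] at this ⊢
  exact this.integrableOn_Icc

theorem map_integral_section [CompleteSpace E] {φ : E →ₗ[ℝ] ℝ} {P : Set E} {lo hi : ℝ}
    (him : φ '' P = Set.Icc lo hi) {s : ℝ → E} (hs : IsSection φ P s) (ψ : E →L[ℝ] ℝ) :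
    ψ (∫ x in φ '' P, s x) = ∫ x in φ '' P, ψ (s x) :=
  (ψ.integral_comp_comm (integrableOn_section him hs)).symm

theorem integral_section_le [CompleteSpace E] {φ : E →ₗ[ℝ] ℝ} {P : Set E} {lo hi : ℝ}
    (him : φ '' P = Set.Icc lo hi) {s γ : ℝ → E} (hs : IsSection φ P s) (hγ : IsSection φ P γ)
    (ψ : E →L[ℝ] ℝ) (h : ∀ x ∈ φ '' P, ψ (s x) ≤ ψ (γ x)) :
    ψ (∫ x in φ '' P, s x) ≤ ψ (∫ x in φ '' P, γ x) := by
  rw [map_integral_section him hs, map_integral_section him hγ]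
  refine MeasureTheory.setIntegral_mono_on (ψ.integrable_comp (integrableOn_section him hs))
    (ψ.integrable_comp (integrableOn_section him hγ)) ?_ h
  rw [him]
  exact measurableSet_Icc

/-- The difference is nonnegative and continuous with integral zero, so it vanishes at every point
of the nondegenerate interval and not just almost everywhere. -/
theorem eqOn_of_integral_section_eq [CompleteSpace E] {φ : E →ₗ[ℝ] ℝ} {P : Set E} {lo hi : ℝ}
    (hlt : lo < hi) (him : φ '' P = Set.Icc lo hi) {s γ : ℝ → E} (hs : IsSection φ P s)
    (hγ : IsSection φ P γ) (ψ : E →L[ℝ] ℝ) (h : ∀ x ∈ φ '' P, ψ (s x) ≤ ψ (γ x))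
    (e : ψ (∫ x in φ '' P, s x) = ψ (∫ x in φ '' P, γ x)) :
    ∀ x ∈ φ '' P, ψ (s x) = ψ (γ x) := by
  have hcs := hs.1
  have hcγ := hγ.1
  have is := ψ.integrable_comp (integrableOn_section him hs)
  have iγ := ψ.integrable_comp (integrableOn_section him hγ)
  rw [map_integral_section him hs, map_integral_section him hγ] at e
  rw [him] at *
  have h0 : ∫ x in Set.Icc lo hi, (ψ (γ x) - ψ (s x)) = 0 := by
    rw [MeasureTheory.integral_sub iγ is, e, sub_self]
  have h1 := (MeasureTheory.setIntegral_eq_zero_iff_of_nonneg_ae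
    (f := fun x => ψ (γ x) - ψ (s x)) ((MeasureTheory.ae_restrict_iff' measurableSet_Icc).2
      (Filter.Eventually.of_forall fun x hx => sub_nonneg.2 (h x hx))) (iγ.sub is)).1 h0
  have h2 := MeasureTheory.Measure.eqOn_Icc_of_ae_eq MeasureTheory.volume hlt.ne h1
    ((ψ.continuous.comp_continuousOn hcγ).sub (ψ.continuous.comp_continuousOn hcs))
    continuousOn_const
  intro x hx
  exact (sub_eq_zero.1 (h2 hx)).symm

/-! ### Recovering a path from its image -/

/-- The vertices on an increasing path are the extreme points on the union of its segments. -/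
theorem mem_iff_mem_segments {P : Set E} {L : List E}
    (hLP : ∀ v ∈ L, v ∈ P.extremePoints ℝ)
    (hne : {x | ∃ p q : E, [p, q] <:+: L ∧ x ∈ segment ℝ p q}.Nonempty) (v : E) :
    v ∈ L ↔ v ∈ P.extremePoints ℝ ∧ ∃ p q : E, [p, q] <:+: L ∧ v ∈ segment ℝ p q := by
  constructor
  · intro hv
    refine ⟨hLP v hv, ?_⟩
    obtain ⟨x, a, b, hab, -⟩ := hne
    match L, hv, hab with
    | [p], _, hab => exact (not_infix_pair_singleton hab).elim
    | p :: q :: L, hv, _ =>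
      obtain ⟨a, b, h, rfl | rfl⟩ := exists_infix_pair_of_mem hv
      · exact ⟨_, _, h, left_mem_segment ..⟩
      · exact ⟨_, _, h, right_mem_segment ..⟩
  · rintro ⟨hv, p, q, h, hpq⟩
    have hp := h.subset (show p ∈ [p, q] by simp)
    have hq := h.subset (show q ∈ [p, q] by simp)
    rcases (mem_extremePoints_iff_forall_segment.1 hv).2 p (hLP p hp).1 q (hLP q hq).1 hpq with
      rfl | rfl
    · exact hp
    · exact hq

theorem eq_of_pairwise_of_mem_iff {φ : E →ₗ[ℝ] ℝ} {L L' : List E} (hL : L.Pairwise (φ · < φ ·))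
    (hL' : L'.Pairwise (φ · < φ ·)) (h : ∀ v, v ∈ L ↔ v ∈ L') : L = L' := by
  refine List.Perm.eq_of_pairwise (le := (φ · < φ ·)) (fun a b _ _ h1 h2 => (lt_asymm h1 h2).elim)
    hL hL' ?_
  rw [List.perm_ext_iff_of_nodup]
  · exact h
  · exact hL.imp fun h e => h.ne (by rw [e])
  · exact hL'.imp fun h e => h.ne (by rw [e])

end General

/-! ### Dominating lines and upper hulls -/

section Coherent

variable {E : Type*} [NormedAddCommGroup E] [NormedSpace ℝ E]

/-- Maximizers of a functional form a face. `V` may be infinite: besides vertices and edges of the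
cross-polytope, this exposes the vertices of the monotone path polytope inside the hull of all
section integrals. -/
theorem isExtreme_convexHull_maximizers {V F : Set E} (ψ : E →ₗ[ℝ] ℝ) {c : ℝ}
    (h : ∀ v ∈ V, ψ v ≤ c) (hF : F ⊆ V) (hVF : ∀ v ∈ V, ψ v = c ↔ v ∈ F) :
    IsExtreme ℝ (convexHull ℝ V) (convexHull ℝ F) := by
  have e : {v ∈ V | ψ v = c} = F :=
    Set.ext fun v => ⟨fun hv => (hVF v hv.1).1 hv.2, fun hv => ⟨hF hv, (hVF v (hF hv)).2 hv⟩⟩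
  have key : ∀ x, x ∈ convexHull ℝ F → ψ x = c := by
    intro x hx
    refine le_antisymm (le_of_mem_convexHull ψ (fun v hv => h v (hF hv)) hx) ?_
    have := le_of_mem_convexHull (-ψ) (c := -c)
      (fun v hv => by simp [(hVF v (hF hv)).2 hv]) hx
    simpa using this
  refine ⟨convexHull_mono hF, fun x hx y hy z hz hxyz => ?_⟩
  rw [← e]
  refine mem_convexHull_maximizers ψ h hx ?_
  have hz := key z hz
  have h1 := le_of_mem_convexHull ψ h hx
  have h2 := le_of_mem_convexHull ψ h hy
  obtain ⟨a, b, ha, hb, hab, rfl⟩ := hxyz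
  simp only [map_add, map_smul, smul_eq_mul] at hz
  have e' : c = a * c + b * c := by rw [← add_mul, hab, one_mul]
  by_contra hne
  have := lt_of_le_of_ne h1 hne
  nlinarith

/-- The list of the elements of a finite set in the order of their `φ`-values. -/
noncomputable def pathList (φ : E →ₗ[ℝ] ℝ) {S : Set E} (hS : S.Finite) : List E :=
  ((hS.image φ).toFinset.sort (· ≤ ·)).map (Function.invFunOn φ S)

theorem mem_pathList {φ : E →ₗ[ℝ] ℝ} {S : Set E} (hS : S.Finite) (hinj : Set.InjOn φ S) {v : E} :
    v ∈ pathList φ hS ↔ v ∈ S := by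
  simp only [pathList, List.mem_map, Finset.mem_sort, Set.Finite.mem_toFinset]
  constructor
  · rintro ⟨t, ht, rfl⟩
    exact Function.invFunOn_mem ht
  · exact fun hv => ⟨φ v, ⟨v, hv, rfl⟩, hinj.leftInvOn_invFunOn hv⟩

theorem pairwise_pathList (φ : E →ₗ[ℝ] ℝ) {S : Set E} (hS : S.Finite) :
    (pathList φ hS).Pairwise (φ · < φ ·) := by
  rw [pathList, List.pairwise_map]
  refine (Finset.sortedLT_sort _).pairwise.imp_of_mem ?_
  intro a b ha hb hab
  simp only [Finset.mem_sort, Set.Finite.mem_toFinset] at ha hb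
  rwa [Function.invFunOn_eq ha, Function.invFunOn_eq hb]

/-- An increasing list with distinct least element `x` and greatest element `y` starts with `x`,
ends with `y` and has length at least two. -/
theorem exists_eq_cons_cons {φ : E →ₗ[ℝ] ℝ} {L : List E} (hL : L.Pairwise (φ · < φ ·)) {x y : E}
    (hx : x ∈ L) (hy : y ∈ L) (hxy : x ≠ y) (hmin : ∀ r ∈ L, φ x ≤ φ r)
    (hmax : ∀ r ∈ L, φ r ≤ φ y) : ∃ q R, L = x :: q :: R ∧ L.getLast? = some y := by
  have hlast : L.getLast? = some y := by
    rcases List.eq_nil_or_concat L with rfl | ⟨K, z, rfl⟩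
    · simp at hy
    · rw [List.concat_eq_append] at *
      rw [List.pairwise_append] at hL
      rcases List.mem_append.1 hy with h | h
      · exact absurd (hL.2.2 y h z (by simp)) (not_lt.2 (hmax z (by simp)))
      · simp at h
        simp [h]
  match L with
  | [] => simp at hx
  | [p] =>
    simp at hx hy
    exact (hxy (hx.trans hy.symm)).elim
  | p :: q :: R =>
    rcases List.mem_cons.1 hx with rfl | h
    · exact ⟨q, R, rfl, hlast⟩
    · exact absurd ((List.pairwise_cons.1 hL).1 x h) (not_lt.2 (hmin p (by simp)))

/-- If every segment of the path `L` is dominated by a line lying above all the vertices, then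
the section traversing `L` maximizes `ψ` on every fiber. -/
theorem le_of_traverses {φ : E →ₗ[ℝ] ℝ} {V : Set E} {L : List E} {s γ : ℝ → E}
    (hγ : Traverses φ (convexHull ℝ V) γ L) (hs : IsSection φ (convexHull ℝ V) s)
    (ψ : E →ₗ[ℝ] ℝ)
    (h : ∀ p q, [p, q] <:+: L → ∃ α β, (∀ v ∈ V, ψ v + α * φ v ≤ β) ∧
      ψ p + α * φ p = β ∧ ψ q + α * φ q = β) :
    ∀ x ∈ φ '' convexHull ℝ V, ψ (s x) ≤ ψ (γ x) := by
  intro x hx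
  obtain ⟨p, q, hpq, hmem⟩ : γ x ∈ {x | ∃ p q : E, [p, q] <:+: L ∧ x ∈ segment ℝ p q} :=
    hγ.2 ▸ ⟨x, hx, rfl⟩
  obtain ⟨α, β, hV, hp, hq⟩ := h p q hpq
  have h1 : (ψ + α • φ) (s x) ≤ β := le_of_mem_convexHull _ (by simpa using hV) (hs.2 x hx).1
  have h2 : (-(ψ + α • φ)) (γ x) ≤ -β := by
    rw [← convexHull_pair] at hmem
    refine le_of_mem_convexHull _ ?_ hmem
    rintro v (rfl | rfl) <;> simp <;> linarith
  -- Both points lie over `x`, so the terms `α * x` cancel.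
  simp [(hs.2 x hx).2] at h1
  simp [(hγ.1.2 x hx).2] at h2
  linarith

/-- If moreover the dominating lines touch only the two ends of their segment, then no other
section attains the maximum. -/
theorem eq_of_traverses {φ : E →ₗ[ℝ] ℝ} {V : Set E} {L : List E} {s γ : ℝ → E}
    (hγ : Traverses φ (convexHull ℝ V) γ L) (hs : IsSection φ (convexHull ℝ V) s)
    (ψ : E →ₗ[ℝ] ℝ)
    (h : ∀ p q, [p, q] <:+: L → φ p < φ q ∧ ∃ α β, (∀ v ∈ V, ψ v + α * φ v ≤ β) ∧
      ∀ v ∈ V, ψ v + α * φ v = β ↔ v = p ∨ v = q) (hLV : ∀ v ∈ L, v ∈ V) :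
    ∀ x ∈ φ '' convexHull ℝ V, ψ (s x) = ψ (γ x) → s x = γ x := by
  intro x hx e
  obtain ⟨p, q, hpq, hmem⟩ : γ x ∈ {x | ∃ p q : E, [p, q] <:+: L ∧ x ∈ segment ℝ p q} :=
    hγ.2 ▸ ⟨x, hx, rfl⟩
  obtain ⟨hlt, α, β, hV, hV'⟩ := h p q hpq
  have hp := (hV' p (hLV _ (hpq.subset (by simp)))).2 (Or.inl rfl)
  have hq := (hV' q (hLV _ (hpq.subset (by simp)))).2 (Or.inr rfl)
  have hV1 : ∀ v ∈ V, (ψ + α • φ) v ≤ β := by simpa using hV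
  have h1 : (ψ + α • φ) (s x) ≤ β := le_of_mem_convexHull _ hV1 (hs.2 x hx).1
  have h2 : (-(ψ + α • φ)) (γ x) ≤ -β := by
    rw [← convexHull_pair] at hmem
    refine le_of_mem_convexHull _ ?_ hmem
    rintro v (rfl | rfl) <;> simp <;> linarith
  have h3 : (ψ + α • φ) (s x) = β := by
    refine le_antisymm h1 ?_
    simp [(hγ.1.2 x hx).2] at h2
    simp [(hs.2 x hx).2, e]
    linarith
  -- Being on the dominating line, `s x` lies in the hull of the vertices on it, the segment `pq`,
  -- where the value of `φ` determines the point.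
  have h4 := mem_convexHull_maximizers _ hV1 (hs.2 x hx).1 h3
  have h5 : s x ∈ segment ℝ p q := by
    rw [← convexHull_pair]
    refine convexHull_mono ?_ h4
    rintro v ⟨hv, hv'⟩
    exact (hV' v hv).1 (by simpa using hv')
  exact eq_of_mem_segment hlt h5 hmem ((hs.2 x hx).2.trans (hγ.1.2 x hx).2.symm)

/-- The line through two consecutive points of the parabola `M² - t²` dominates every vertex. -/
theorem parabola_dominates {φ ψ : E →ₗ[ℝ] ℝ} {V S : Set E} {M : ℝ} (hinj : Set.InjOn φ V)
    (hSV : S ⊆ V) (hS : ∀ v ∈ S, ψ v = M ^ 2 - φ v ^ 2)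
    (hVS : ∀ v ∈ V, v ∉ S → ψ v ≤ 0 ∧ |φ v| < M) (hM : ∀ v ∈ S, |φ v| ≤ M)
    (hr : ∃ r ∈ S, |φ r| < M) {p q : E} (hp : p ∈ S) (hq : q ∈ S) (hlt : φ p < φ q)
    (hpq : ∀ r ∈ S, φ r ≤ φ p ∨ φ q ≤ φ r) {v : E} (hv : v ∈ V) :
    ψ v + (φ p + φ q) * φ v ≤ M ^ 2 + φ p * φ q ∧
      (ψ v + (φ p + φ q) * φ v = M ^ 2 + φ p * φ q ↔ v = p ∨ v = q) := by
  by_cases hvS : v ∈ S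
  · rw [hS v hvS]
    constructor
    · rcases hpq v hvS with h | h
      · nlinarith [mul_nonneg (sub_nonneg.2 h) (sub_nonneg.2 (h.trans hlt.le))]
      · nlinarith [mul_nonneg (sub_nonneg.2 h) (sub_nonneg.2 (hlt.le.trans h))]
    · constructor
      · intro h
        have : (φ v - φ p) * (φ q - φ v) = 0 := by linarith
        rcases mul_eq_zero.1 this with h | h
        · exact Or.inl (hinj hv (hSV hp) (sub_eq_zero.1 h))
        · exact Or.inr (hinj hv (hSV hq) (sub_eq_zero.1 h).symm)
      · rintro (rfl | rfl) <;> ring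
  · obtain ⟨h0, hvM⟩ := hVS v hv hvS
    have hlt' : ψ v + (φ p + φ q) * φ v < M ^ 2 + φ p * φ q := by
      obtain ⟨r, hrS, hrM⟩ := hr
      have hp1 := abs_le.1 (hM p hp)
      have hq1 := abs_le.1 (hM q hq)
      have hv1 := abs_lt.1 hvM
      have hr1 := abs_lt.1 hrM
      -- The affine function `M² + φ p φ q - (φ p + φ q) t` takes the values `(M + φ p)(M + φ q)` at
      -- `t = -M` and `(M - φ p)(M - φ q)` at `t = M`; this is `2M` times its interpolation at `φ
      -- v`. The point `r` prevents `p, q` from being the two ends `±M`, where both values would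
      -- vanish.
      have key : 0 < (M - φ v) * ((M + φ p) * (M + φ q)) + (M + φ v) * ((M - φ p) * (M - φ q)) := by
        have n1 : 0 ≤ (M + φ p) * (M + φ q) := mul_nonneg (by linarith) (by linarith)
        have n2 : 0 ≤ (M - φ p) * (M - φ q) := mul_nonneg (by linarith) (by linarith)
        rcases hpq r hrS with h | h
        · have : 0 < (M + φ p) * (M + φ q) := mul_pos (by linarith) (by linarith)
          have := mul_pos (sub_pos.2 hv1.2) this
          have := mul_nonneg (show 0 ≤ M + φ v by linarith) n2
          linarith
        · have : 0 < (M - φ p) * (M - φ q) := mul_pos (by linarith) (by linarith)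
          have := mul_pos (show 0 < M + φ v by linarith) this
          have := mul_nonneg (show 0 ≤ M - φ v by linarith) n1
          linarith
      have e : (M - φ v) * ((M + φ p) * (M + φ q)) + (M + φ v) * ((M - φ p) * (M - φ q)) =
        2 * M * (M ^ 2 + φ p * φ q - (φ p + φ q) * φ v) := by ring
      rw [e] at key
      have := (pos_iff_pos_of_mul_pos key).1 (by linarith)
      linarith
    refine ⟨hlt'.le, fun h => absurd h hlt'.ne, ?_⟩
    rintro (rfl | rfl)
    · exact (hvS hp).elim
    · exact (hvS hq).elim

/-- The points of `V` maximizing `ψ - c φ` for some slope `c`. -/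
def upperHull (φ ψ : E →ₗ[ℝ] ℝ) (V : Set E) : Set E :=
  {v ∈ V | ∃ c : ℝ, ∀ u ∈ V, ψ u - c * φ u ≤ ψ v - c * φ v}

/-- The line through two consecutive points of the upper hull dominates every vertex. -/
theorem upperHull_dominates {φ ψ : E →ₗ[ℝ] ℝ} {V S : Set E} (hV : V.Finite)
    (hinj : Set.InjOn φ V) (hS : upperHull φ ψ V ⊆ S) (hSV : S ⊆ V)
    (hS' : ∀ v ∈ S, v ∈ upperHull φ ψ V ∨ (∀ u ∈ V, φ v ≤ φ u) ∨ ∀ u ∈ V, φ u ≤ φ v)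
    {p q : E} (hp : p ∈ S) (hq : q ∈ S) (hlt : φ p < φ q)
    (hpq : ∀ r ∈ S, φ r ≤ φ p ∨ φ q ≤ φ r) :
    ∃ α β, (∀ v ∈ V, ψ v + α * φ v ≤ β) ∧ ψ p + α * φ p = β ∧ ψ q + α * φ q = β := by
  obtain ⟨c, hc⟩ : ∃ c : ℝ, ψ p - c * φ p = ψ q - c * φ q := by
    refine ⟨(ψ q - ψ p) / (φ q - φ p), ?_⟩
    have : φ q - φ p ≠ 0 := (sub_pos.2 hlt).ne'
    field_simp
    ring
  refine ⟨-c, ψ p - c * φ p, ?_, by ring, by rw [hc]; ring⟩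
  -- If the highest vertex `r` relative to the slope `c` were above the line `pq`, it would lie
  -- strictly left of `p` or right of `q`. Then `p` would be strictly below the chord `rq`, or `q`
  -- below `pr`, so it could have no supporting slope; nor is it extreme for `φ`.
  obtain ⟨r, hr, hmax⟩ := hV.exists_maximalFor (fun v => ψ v - c * φ v) V ⟨p, hSV hp⟩
    |>.imp fun r h => And.intro h.1 fun u hu => (le_total (ψ u - c * φ u) (ψ r - c * φ r)).elim id
      fun h' => h.2 hu h'
  suffices h : ψ r - c * φ r ≤ ψ p - c * φ p by
    intro v hv
    linarith [hmax v hv]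
  by_contra! hgt
  have hrS : r ∈ S := hS ⟨hr, c, hmax⟩
  rcases hpq r hrS with h | h
  · have h' : φ r < φ p := lt_of_le_of_ne h fun e => by
      rw [hinj hr (hSV hp) e] at hgt
      exact hgt.false
    rcases hS' p hp with ⟨-, d, hd⟩ | h1 | h1
    · have h2 := hd r hr
      have h3 := hd q (hSV hq)
      nlinarith
    · exact absurd (h1 r hr) (not_le.2 h')
    · exact absurd (h1 q (hSV hq)) (not_le.2 hlt)
  · have h' : φ q < φ r := lt_of_le_of_ne h fun e => by
      rw [← hinj (hSV hq) hr e, hc] at hgt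
      exact hgt.false
    rcases hS' q hq with ⟨-, d, hd⟩ | h1 | h1
    · have h2 := hd r hr
      have h3 := hd p (hSV hp)
      nlinarith
    · exact absurd (h1 p (hSV hp)) (not_le.2 hlt)
    · exact absurd (h1 r hr) (not_le.2 h')

/-- If `ψ` vanishes on the `φ`-maximal vertex but not on all vertices, the upper hull contains no
other pair of antipodes. -/
theorem not_neg_mem_upperHull {φ ψ : E →ₗ[ℝ] ℝ} {V : Set E} {top : E} (htop : top ∈ V)
    (hneg : ∀ v ∈ V, -v ∈ V) (h0 : ψ top = 0) (hne : ∃ v ∈ V, ψ v ≠ 0) {v : E}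
    (hv : |φ v| < φ top) (h1 : v ∈ upperHull φ ψ V) : -v ∉ upperHull φ ψ V := by
  rintro ⟨-, d, hd⟩
  obtain ⟨-, c, hc⟩ := h1
  obtain ⟨w, hw, hw0⟩ := hne
  have hv' := abs_lt.1 hv
  have c1 := hc top htop
  have c2 := hc _ (hneg _ htop)
  have d1 := hd top htop
  have d2 := hd _ (hneg _ htop)
  simp only [map_neg, h0] at c1 c2 d1 d2
  -- Comparison with `± top` gives `ψ v ≥ |c| (φ top - |φ v|) ≥ 0`, and likewise `-ψ v ≥ 0` from the
  -- slope `d`. So `ψ v = 0`, which forces `c = 0`; then 0 is the maximum of `ψ` on the symmetric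
  -- set `V`, and `ψ` vanishes there.
  have hψ : ψ v = 0 := by
    apply le_antisymm
    · rcases le_total 0 d with h | h <;> nlinarith
    · rcases le_total 0 c with h | h <;> nlinarith
  have hc0 : c = 0 := by
    rcases lt_trichotomy c 0 with h | h | h
    · nlinarith
    · exact h
    · nlinarith
  have e1 := hc w hw
  have e2 := hc _ (hneg _ hw)
  simp only [hψ, hc0, map_neg] at e1 e2
  exact hw0 (by linarith)

/-- The maximizer of `ψ` has slope 0, and by symmetry of `V` its value is positive. This is what
makes the sign vector of the upper hull nonzero. -/
theorem exists_mem_upperHull {φ ψ : E →ₗ[ℝ] ℝ} {V : Set E} {top : E} (hV : V.Finite)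
    (hneg : ∀ v ∈ V, -v ∈ V) (h0 : ψ top = 0) (hne : ∃ v ∈ V, ψ v ≠ 0) :
    ∃ r ∈ upperHull φ ψ V, r ≠ top ∧ r ≠ -top := by
  obtain ⟨w, hw, hw0⟩ := hne
  obtain ⟨r, hr, hmax⟩ := hV.exists_maximalFor (fun v => ψ v) V ⟨w, hw⟩
    |>.imp fun r h => And.intro h.1 fun u hu => (le_total (ψ u) (ψ r)).elim id
      fun h' => h.2 hu h'
  have hpos : 0 < ψ r := by
    have h1 := hmax w hw
    have h2 := hmax _ (hneg w hw)
    rw [map_neg] at h2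
    rcases lt_or_gt_of_ne hw0 with h | h <;> linarith
  refine ⟨r, ⟨hr, 0, by simpa using hmax⟩, ?_, ?_⟩
  · rintro rfl
    exact hpos.ne' h0
  · rintro rfl
    simp [h0] at hpos

end Coherent

/-! ### Vertices of the cross-polytope and sign vectors -/

section CrossPolytope

variable {n : ℕ}

/-- The vertices `± eᵢ` of the cross-polytope. -/
def crossVertices (n : ℕ) : Set (Fin n → ℝ) :=
  {v | ∃ i : Fin n, v = stdVec i ∨ v = -stdVec i}

theorem crossPolytope_eq (n : ℕ) : crossPolytope n = convexHull ℝ (crossVertices n) := rfl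

theorem stdVec_mem (i : Fin n) : stdVec i ∈ crossVertices n := ⟨i, Or.inl rfl⟩

theorem neg_mem_crossVertices {v : Fin n → ℝ} (hv : v ∈ crossVertices n) :
    -v ∈ crossVertices n := by
  obtain ⟨i, rfl | rfl⟩ := hv
  · exact ⟨i, Or.inr rfl⟩
  · exact ⟨i, Or.inl (neg_neg _)⟩

theorem neg_stdVec_mem (i : Fin n) : -stdVec i ∈ crossVertices n := ⟨i, Or.inr rfl⟩

theorem finite_crossVertices (n : ℕ) : (crossVertices n).Finite := by
  have : crossVertices n = Set.range (stdVec : Fin n → _) ∪ Set.range fun i : Fin n => -stdVec i := by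
    ext v
    simp only [crossVertices, Set.mem_ofPred_eq, Set.mem_union, Set.mem_range, exists_or, eq_comm]
  rw [this]
  exact (Set.finite_range _).union (Set.finite_range _)

theorem stdVec_injective : Function.Injective (stdVec : Fin n → _) := fun i j h => by
  by_contra hne
  have := congrFun h i
  simp [stdVec, hne] at this

theorem stdVec_ne_neg (i j : Fin n) : stdVec i ≠ -stdVec j := fun h => by
  have h1 := congrFun h i
  by_cases e : i = j
  · subst e
    simp [stdVec] at h1
    linarith
  · simp [stdVec, e] at h1

/-- For `v = ± eᵢ`, the functional `x ↦ v i * x i` is 1 at `v` and at most 0 at every other vertex.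
-/
theorem mem_extremePoints_of_mem_crossVertices {v : Fin n → ℝ} (hv : v ∈ crossVertices n) :
    v ∈ (crossPolytope n).extremePoints ℝ := by
  rw [← isExtreme_singleton, ← convexHull_singleton (𝕜 := ℝ) v, crossPolytope_eq]
  obtain ⟨i, hi⟩ := hv
  have hvi : v i * v i = 1 := by rcases hi with rfl | rfl <;> simp [stdVec]
  have hval : ∀ u ∈ crossVertices n, v i * u i = 1 ∨ v i * u i ≤ 0 := by
    rintro u ⟨j, rfl | rfl⟩ <;> rcases hi with rfl | rfl <;> by_cases e : i = j <;>
      simp [stdVec, e]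
  refine isExtreme_convexHull_maximizers (c := 1) (v i • LinearMap.proj i) ?_ ?_ ?_
  · intro u hu
    have := hval u hu
    simp only [LinearMap.smul_apply, LinearMap.proj_apply, smul_eq_mul]
    rcases this with h | h <;> linarith
  · rintro _ rfl
    exact ⟨i, hi⟩
  · rintro u ⟨j, hj⟩
    simp only [LinearMap.smul_apply, LinearMap.proj_apply, smul_eq_mul, Set.mem_singleton_iff]
    constructor
    · intro h
      rcases hj with rfl | rfl <;> rcases hi with rfl | rfl <;> by_cases e : i = j <;>
        simp [stdVec, e] at h ⊢ <;> linarith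
    · rintro rfl
      exact hvi

theorem extremePoints_crossPolytope (n : ℕ) :
    (crossPolytope n).extremePoints ℝ = crossVertices n :=
  Set.Subset.antisymm extremePoints_convexHull_subset
    fun _ hv => mem_extremePoints_of_mem_crossVertices hv

/-- The vertices selected by the sign vector `σ`, together with `± eₘ`. -/
def signVertices (m : Fin n) (σ : {i : Fin n // i ≠ m} → SignType) : Set (Fin n → ℝ) :=
  {v | (v = stdVec m ∨ v = -stdVec m) ∨
    ∃ i : {i : Fin n // i ≠ m}, (σ i = 1 ∧ v = stdVec i.1) ∨ (σ i = -1 ∧ v = -stdVec i.1)}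

theorem signVertices_subset (m : Fin n) (σ : {i : Fin n // i ≠ m} → SignType) :
    signVertices m σ ⊆ crossVertices n := by
  rintro v (h | ⟨i, ⟨-, h⟩ | ⟨-, h⟩⟩)
  · exact ⟨m, h⟩
  · exact ⟨i, Or.inl h⟩
  · exact ⟨i, Or.inr h⟩

theorem finite_signVertices (m : Fin n) (σ : {i : Fin n // i ≠ m} → SignType) :
    (signVertices m σ).Finite :=
  (finite_crossVertices n).subset (signVertices_subset m σ)

theorem stdVec_mem_signVertices {m : Fin n} {σ : {i : Fin n // i ≠ m} → SignType}
    (i : {i : Fin n // i ≠ m}) : stdVec i.1 ∈ signVertices m σ ↔ σ i = 1 := by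
  constructor
  · rintro ((h | h) | ⟨j, ⟨h, h'⟩ | ⟨h, h'⟩⟩)
    · exact (i.2 (stdVec_injective h)).elim
    · exact (stdVec_ne_neg _ _ h).elim
    · rwa [Subtype.ext (stdVec_injective h')]
    · exact (stdVec_ne_neg _ _ h').elim
  · exact fun h => Or.inr ⟨i, Or.inl ⟨h, rfl⟩⟩

theorem neg_stdVec_mem_signVertices {m : Fin n} {σ : {i : Fin n // i ≠ m} → SignType}
    (i : {i : Fin n // i ≠ m}) : -stdVec i.1 ∈ signVertices m σ ↔ σ i = -1 := by
  constructor
  · rintro ((h | h) | ⟨j, ⟨h, h'⟩ | ⟨h, h'⟩⟩)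
    · exact (stdVec_ne_neg _ _ h.symm).elim
    · exact (i.2 (stdVec_injective (neg_injective h))).elim
    · exact (stdVec_ne_neg _ _ h'.symm).elim
    · rwa [Subtype.ext (stdVec_injective (neg_injective h'))]
  · exact fun h => Or.inr ⟨i, Or.inr ⟨h, rfl⟩⟩

theorem exists_dominant_index (hn : 2 ≤ n) {φ : (Fin n → ℝ) →ₗ[ℝ] ℝ}
    (hinj : Set.InjOn φ (crossVertices n)) :
    ∃ m : Fin n, ∀ i, i ≠ m → |φ (stdVec i)| < |φ (stdVec m)| := by
  have : NeZero n := ⟨by omega⟩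
  obtain ⟨m, -, hm⟩ := Finset.exists_max_image Finset.univ (fun i : Fin n => |φ (stdVec i)|)
    ⟨0, Finset.mem_univ _⟩
  refine ⟨m, fun i hi => lt_of_le_of_ne (hm i (Finset.mem_univ _)) fun e => ?_⟩
  rcases abs_eq_abs.1 e with h | h
  · exact hi (stdVec_injective (hinj (stdVec_mem _) (stdVec_mem _) h))
  · rw [← map_neg] at h
    exact stdVec_ne_neg _ _ (hinj (stdVec_mem _) (neg_stdVec_mem _) h)

/-- The functional whose values on the vertices selected by `σ` lie on the parabola
`φ(eₘ)² - t²`. -/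
noncomputable def signFunctional (φ : (Fin n → ℝ) →ₗ[ℝ] ℝ) (m : Fin n)
    (σ : {i : Fin n // i ≠ m} → SignType) : (Fin n → ℝ) →ₗ[ℝ] ℝ :=
  ∑ i : {i : Fin n // i ≠ m},
    ((σ i : ℝ) * (φ (stdVec m) ^ 2 - φ (stdVec i.1) ^ 2)) • LinearMap.proj i.1

theorem signFunctional_dominant (φ : (Fin n → ℝ) →ₗ[ℝ] ℝ) (m : Fin n)
    (σ : {i : Fin n // i ≠ m} → SignType) : signFunctional φ m σ (stdVec m) = 0 := by
  simp only [signFunctional, LinearMap.sum_apply, LinearMap.smul_apply, LinearMap.proj_apply]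
  refine Finset.sum_eq_zero fun i _ => ?_
  simp [stdVec, i.2]

theorem signFunctional_stdVec (φ : (Fin n → ℝ) →ₗ[ℝ] ℝ) (m : Fin n)
    (σ : {i : Fin n // i ≠ m} → SignType) (i : {i : Fin n // i ≠ m}) :
    signFunctional φ m σ (stdVec i.1) =
      (σ i : ℝ) * (φ (stdVec m) ^ 2 - φ (stdVec i.1) ^ 2) := by
  simp only [signFunctional, LinearMap.sum_apply, LinearMap.smul_apply, LinearMap.proj_apply]
  rw [Finset.sum_eq_single i]
  · simp [stdVec]
  · intro j _ hj
    simp [stdVec, Subtype.coe_injective.ne hj]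
  · simp

end CrossPolytope

/-! ### The monotone path of a sign vector -/

section CrossPolytopePaths

variable {n : ℕ} {φ : (Fin n → ℝ) →ₗ[ℝ] ℝ} {m : Fin n}

theorem abs_lt_dominant (hm : ∀ i, i ≠ m → |φ (stdVec i)| < |φ (stdVec m)|) {v : Fin n → ℝ}
    (hv : v ∈ crossVertices n) (h1 : v ≠ stdVec m) (h2 : v ≠ -stdVec m) :
    |φ v| < |φ (stdVec m)| := by
  obtain ⟨i, rfl | rfl⟩ := hv
  · exact hm i fun e => h1 (by rw [e])
  · rw [map_neg, abs_neg]
    exact hm i fun e => h2 (by rw [e])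

theorem abs_le_dominant (hm : ∀ i, i ≠ m → |φ (stdVec i)| < |φ (stdVec m)|) {v : Fin n → ℝ}
    (hv : v ∈ crossVertices n) : |φ v| ≤ |φ (stdVec m)| := by
  by_cases h1 : v = stdVec m
  · rw [h1]
  by_cases h2 : v = -stdVec m
  · rw [h2, map_neg, abs_neg]
  exact (abs_lt_dominant hm hv h1 h2).le

theorem exists_top (φ : (Fin n → ℝ) →ₗ[ℝ] ℝ) (m : Fin n) :
    ∃ top : Fin n → ℝ, φ top = |φ (stdVec m)| ∧
      ∀ v, (v = top ∨ v = -top) ↔ (v = stdVec m ∨ v = -stdVec m) := by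
  rcases le_total 0 (φ (stdVec m)) with h | h
  · exact ⟨stdVec m, (abs_of_nonneg h).symm, fun v => Iff.rfl⟩
  · exact ⟨-stdVec m, by rw [map_neg, abs_of_nonpos h], fun v => by rw [neg_neg, or_comm]⟩

theorem dominant_pos (hinj : Set.InjOn φ (crossVertices n)) : 0 < |φ (stdVec m)| := by
  refine abs_pos.2 fun h => stdVec_ne_neg m m (hinj (stdVec_mem _) (neg_stdVec_mem _) ?_)
  rw [map_neg, h, neg_zero]

theorem image_crossPolytope (hm : ∀ i, i ≠ m → |φ (stdVec i)| < |φ (stdVec m)|) :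
    φ '' crossPolytope n = Set.Icc (-|φ (stdVec m)|) |φ (stdVec m)| := by
  have hsub := subset_convexHull ℝ (crossVertices n)
  apply Set.Subset.antisymm
  · rintro _ ⟨x, hx, rfl⟩
    have h1 := le_of_mem_convexHull φ
      (fun v hv => (abs_le.1 (abs_le_dominant hm hv)).2) hx
    have h2 := le_of_mem_convexHull (-φ) (c := |φ (stdVec m)|)
      (fun v hv => by
        have := (abs_le.1 (abs_le_dominant hm hv)).1
        simp only [LinearMap.neg_apply]
        linarith) hx
    simp only [LinearMap.neg_apply] at h2
    exact ⟨by linarith, h1⟩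
  · obtain ⟨top, htop, hiff⟩ := exists_top φ m
    have h1 : top ∈ crossVertices n := ⟨m, (hiff top).1 (Or.inl rfl)⟩
    refine ((convex_convexHull ℝ (crossVertices n)).linear_image φ).ordConnected.out ?_ ?_
    · exact ⟨-top, hsub (neg_mem_crossVertices h1), by rw [map_neg, htop]⟩
    · exact ⟨top, hsub h1, htop⟩

/-- The monotone path through the vertices selected by the sign vector `σ`. -/
noncomputable def signPath (φ : (Fin n → ℝ) →ₗ[ℝ] ℝ) (m : Fin n)
    (σ : {i : Fin n // i ≠ m} → SignType) : List (Fin n → ℝ) :=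
  pathList φ (finite_signVertices m σ)

theorem mem_signPath (hinj : Set.InjOn φ (crossVertices n))
    {σ : {i : Fin n // i ≠ m} → SignType} {v : Fin n → ℝ} :
    v ∈ signPath φ m σ ↔ v ∈ signVertices m σ :=
  mem_pathList _ (hinj.mono (signVertices_subset m σ))

theorem pairwise_signPath (φ : (Fin n → ℝ) →ₗ[ℝ] ℝ) (m : Fin n)
    (σ : {i : Fin n // i ≠ m} → SignType) : (signPath φ m σ).Pairwise (φ · < φ ·) :=
  pairwise_pathList φ _

theorem signPath_eq_cons_cons (hinj : Set.InjOn φ (crossVertices n))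
    (hm : ∀ i, i ≠ m → |φ (stdVec i)| < |φ (stdVec m)|) (σ : {i : Fin n // i ≠ m} → SignType) :
    ∃ x y q R, signPath φ m σ = x :: q :: R ∧ (signPath φ m σ).getLast? = some y ∧
      φ x = -|φ (stdVec m)| ∧ φ y = |φ (stdVec m)| := by
  obtain ⟨top, htop, hiff⟩ := exists_top φ m
  have hneg : φ (-top) = -|φ (stdVec m)| := by rw [map_neg, htop]
  have hbd : ∀ r ∈ signPath φ m σ, |φ r| ≤ |φ (stdVec m)| := fun r hr =>
    abs_le_dominant hm (signVertices_subset m σ ((mem_signPath hinj).1 hr))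
  obtain ⟨q, R, h1, h2⟩ := exists_eq_cons_cons (pairwise_signPath φ m σ) (x := -top) (y := top)
    ((mem_signPath hinj).2 (Or.inl ((hiff _).1 (Or.inr rfl))))
    ((mem_signPath hinj).2 (Or.inl ((hiff _).1 (Or.inl rfl))))
    (fun e => by
      have := dominant_pos (m := m) hinj
      have := congrArg φ e
      linarith)
    (fun r hr => hneg ▸ (abs_le.1 (hbd r hr)).1) (fun r hr => htop ▸ (abs_le.1 (hbd r hr)).2)
  exact ⟨-top, top, q, R, h1, h2, hneg, htop⟩

/-- The zero sign vector is allowed: its list joins `∓ eₘ` directly by a diagonal, which is still a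
section. Thus one family of sections can be chosen over all `σ`. -/
theorem exists_traverses_signPath (hinj : Set.InjOn φ (crossVertices n))
    (hm : ∀ i, i ≠ m → |φ (stdVec i)| < |φ (stdVec m)|) (σ : {i : Fin n // i ≠ m} → SignType) :
    ∃ γ, Traverses φ (crossPolytope n) γ (signPath φ m σ) := by
  obtain ⟨x, y, q, R, h1, h2, hx, hy⟩ := signPath_eq_cons_cons hinj hm σ
  have hpw := pairwise_signPath φ m σ
  have hV : ∀ v ∈ signPath φ m σ, v ∈ crossPolytope n := fun v hv =>
    subset_convexHull ℝ _ (signVertices_subset m σ ((mem_signPath hinj).1 hv))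
  rw [h1] at *
  exact ⟨_, traverses_polyline (convex_convexHull ℝ _) hpw.isChain hV ⟨y, h2, rfl⟩
    (by rw [hx, hy]; exact image_crossPolytope hm)⟩

/-- The value of `signFunctional` at the vertices. -/
theorem signFunctional_apply (hm : ∀ i, i ≠ m → |φ (stdVec i)| < |φ (stdVec m)|)
    (σ : {i : Fin n // i ≠ m} → SignType) {v : Fin n → ℝ} (hv : v ∈ crossVertices n) :
    (v ∈ signVertices m σ → signFunctional φ m σ v = |φ (stdVec m)| ^ 2 - φ v ^ 2) ∧
      (v ∉ signVertices m σ → signFunctional φ m σ v ≤ 0 ∧ |φ v| < |φ (stdVec m)|) := by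
  rw [sq_abs]
  constructor
  · rintro ((rfl | rfl) | ⟨i, ⟨h, rfl⟩ | ⟨h, rfl⟩⟩)
    · rw [signFunctional_dominant, sub_self]
    · rw [map_neg, signFunctional_dominant, map_neg]
      ring
    · rw [signFunctional_stdVec, h]
      simp
    · rw [map_neg, signFunctional_stdVec, h, map_neg]
      simp
  · intro hvS
    refine ⟨?_, abs_lt_dominant hm hv (fun h => hvS (Or.inl (Or.inl h)))
      fun h => hvS (Or.inl (Or.inr h))⟩
    obtain ⟨i, hi⟩ := hv
    by_cases him : i = m
    · subst him
      exact (hvS (Or.inl hi)).elim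
    -- At an unselected vertex the sign in `σ` is zero or opposite, so the functional is 0 or minus
    -- this positive number.
    have hpos := sub_pos.2 (sq_lt_sq.2 (hm i him))
    rcases hi with rfl | rfl
    · rw [stdVec_mem_signVertices ⟨i, him⟩] at hvS
      rw [signFunctional_stdVec φ m σ ⟨i, him⟩]
      cases h : σ ⟨i, him⟩ <;> simp_all
      linarith
    · rw [neg_stdVec_mem_signVertices ⟨i, him⟩] at hvS
      rw [map_neg, signFunctional_stdVec φ m σ ⟨i, him⟩]
      cases h : σ ⟨i, him⟩ <;> simp_all
      linarith

theorem exists_mem_signVertices (hm : ∀ i, i ≠ m → |φ (stdVec i)| < |φ (stdVec m)|)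
    {σ : {i : Fin n // i ≠ m} → SignType} (hσ : σ ≠ 0) :
    ∃ r ∈ signVertices m σ, |φ r| < |φ (stdVec m)| := by
  obtain ⟨i, hi⟩ := Function.ne_iff.1 hσ
  have := hm i i.2
  cases h : σ i
  · exact (hi h).elim
  · exact ⟨_, (neg_stdVec_mem_signVertices i).2 h, by rwa [map_neg, abs_neg]⟩
  · exact ⟨_, (stdVec_mem_signVertices i).2 h, this⟩

/-- Every segment of the path of a nonzero sign vector is an edge supported by `signFunctional`
up to a multiple of `φ`. -/
theorem signPath_supported (hinj : Set.InjOn φ (crossVertices n))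
    (hm : ∀ i, i ≠ m → |φ (stdVec i)| < |φ (stdVec m)|)
    {σ : {i : Fin n // i ≠ m} → SignType} (hσ : σ ≠ 0) {p q : Fin n → ℝ}
    (hpq : [p, q] <:+: signPath φ m σ) :
    φ p < φ q ∧ ∃ α β, (∀ v ∈ crossVertices n, signFunctional φ m σ v + α * φ v ≤ β) ∧
      ∀ v ∈ crossVertices n, signFunctional φ m σ v + α * φ v = β ↔ v = p ∨ v = q := by
  obtain ⟨hp, hq, hlt, hcons⟩ := pairwise_consecutive (pairwise_signPath φ m σ) hpq
  simp only [mem_signPath hinj] at hp hq hcons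
  have hsub := signVertices_subset m σ
  have key := fun v (hv : v ∈ crossVertices n) =>
    parabola_dominates (ψ := signFunctional φ m σ) (M := |φ (stdVec m)|) hinj hsub
    (fun v hv => (signFunctional_apply hm σ (hsub hv)).1 hv)
    (fun v hv => (signFunctional_apply hm σ hv).2) (fun v hv => abs_le_dominant hm (hsub hv))
    (exists_mem_signVertices hm hσ) hp hq hlt hcons hv
  exact ⟨hlt, _, _, fun v hv => (key v hv).1, fun v hv => (key v hv).2⟩

/-- The dominating line of two consecutive vertices touches no third vertex, so their segment is a
face. -/
theorem isMonotonePath_signPath (hinj : Set.InjOn φ (crossVertices n))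
    (hm : ∀ i, i ≠ m → |φ (stdVec i)| < |φ (stdVec m)|)
    {σ : {i : Fin n // i ≠ m} → SignType} (hσ : σ ≠ 0) :
    IsMonotonePath φ (crossPolytope n) (signPath φ m σ) := by
  have hsub : ∀ v ∈ signPath φ m σ, v ∈ crossVertices n := fun v hv =>
    signVertices_subset m σ ((mem_signPath hinj).1 hv)
  obtain ⟨x, y, q, R, h1, h2, hx, hy⟩ := signPath_eq_cons_cons hinj hm σ
  have him : ∀ z ∈ crossPolytope n, φ z ∈ Set.Icc (-|φ (stdVec m)|) |φ (stdVec m)| := fun z hz =>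
    image_crossPolytope hm ▸ ⟨z, hz, rfl⟩
  refine ⟨fun p hp => mem_extremePoints_of_mem_crossVertices (hsub p hp), ?_, ?_, ?_⟩
  · refine ⟨x, by simp [h1], fun z hz => ?_⟩
    simp only [Set.mem_ofPred_eq, hx]
    exact (him z hz).1
  · refine ⟨y, h2, fun z hz => ?_⟩
    simp only [Set.mem_ofPred_eq, hy]
    exact (him z hz).2
  · rw [List.isChain_iff_forall_rel_of_append_cons_cons]
    intro p q l₁ l₂ h
    have hpq : [p, q] <:+: signPath φ m σ := ⟨l₁, l₂, by simp [h]⟩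
    obtain ⟨hlt, α, β, hV, hV'⟩ := signPath_supported hinj hm hσ hpq
    refine ⟨hlt, ?_⟩
    rw [← convexHull_pair]
    refine isExtreme_convexHull_maximizers (signFunctional φ m σ + α • φ) (c := β)
      (V := crossVertices n) (fun v hv => by simpa using hV v hv) ?_
      (fun v hv => by simpa using hV' v hv)
    rintro v (rfl | rfl)
    · exact hsub _ (hpq.subset (by simp))
    · exact hsub _ (hpq.subset (by simp))

/-- For every linear functional `ψ`, the path of some nonzero sign vector is dominated by lines
lying above all vertices, i.e. it runs along the upper boundary of the image under `(φ, ψ)`. -/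
theorem exists_signPath_dominating (hn : 2 ≤ n) (hinj : Set.InjOn φ (crossVertices n))
    (hm : ∀ i, i ≠ m → |φ (stdVec i)| < |φ (stdVec m)|) (ψ : (Fin n → ℝ) →ₗ[ℝ] ℝ) :
    ∃ σ : {i : Fin n // i ≠ m} → SignType, σ ≠ 0 ∧ ∀ p q, [p, q] <:+: signPath φ m σ →
      ∃ α β, (∀ v ∈ crossVertices n, ψ v + α * φ v ≤ β) ∧
        ψ p + α * φ p = β ∧ ψ q + α * φ q = β := by
  classical
  have hM := dominant_pos (m := m) hinj
  -- Subtracting a multiple of `φ` from `ψ` only shifts the slopes `α`.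
  wlog h0 : ψ (stdVec m) = 0 generalizing ψ
  · obtain ⟨σ, hσ, h⟩ := this (ψ - (ψ (stdVec m) / φ (stdVec m)) • φ) (by
      simp [div_mul_cancel₀ _ (abs_pos.1 hM)])
    refine ⟨σ, hσ, fun p q hpq => ?_⟩
    obtain ⟨α, β, h1, h2, h3⟩ := h p q hpq
    refine ⟨α - ψ (stdVec m) / φ (stdVec m), β, fun v hv => ?_, ?_, ?_⟩
    · have := h1 v hv
      simp only [LinearMap.sub_apply, LinearMap.smul_apply, smul_eq_mul] at this
      linarith
    · simp only [LinearMap.sub_apply, LinearMap.smul_apply, smul_eq_mul] at h2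
      linarith
    · simp only [LinearMap.sub_apply, LinearMap.smul_apply, smul_eq_mul] at h3
      linarith
  by_cases hne : ∃ v ∈ crossVertices n, ψ v ≠ 0
  swap
  · push Not at hne
    have : Nontrivial (Fin n) := Fin.nontrivial_iff_two_le.2 hn
    obtain ⟨i, hi⟩ := exists_ne m
    -- Here `ψ` is zero on all vertices, so any path will do; the constant 1 is a nonzero sign
    -- vector because `n ≥ 2`.
    refine ⟨fun _ => 1, fun h => by simpa using congrFun h ⟨i, hi⟩, fun p q hpq => ?_⟩
    have hsub : ∀ v ∈ [p, q], v ∈ crossVertices n := fun v hv =>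
      signVertices_subset _ _ ((mem_signPath hinj).1 (hpq.subset hv))
    exact ⟨0, 0, fun v hv => by simp [hne v hv], by simp [hne p (hsub p (by simp))],
      by simp [hne q (hsub q (by simp))]⟩
  obtain ⟨top, htop, hiff⟩ := exists_top φ m
  have htopV : top ∈ crossVertices n := ⟨m, (hiff top).1 (Or.inl rfl)⟩
  have h0' : ψ top = 0 := by
    rcases (hiff top).1 (Or.inl rfl) with h | h <;> simp [h, h0]
  set T := upperHull φ ψ (crossVertices n) with hT
  have hanti : ∀ i : {i : Fin n // i ≠ m}, stdVec i.1 ∈ T → -stdVec i.1 ∉ T := fun i hi =>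
    not_neg_mem_upperHull htopV (fun v hv => neg_mem_crossVertices hv) h0' hne
      (htop ▸ hm i i.2) hi
  -- By `hanti` the first two cases exclude each other, so `σ` records `T` faithfully away from `±
  -- eₘ`.
  let σ : {i : Fin n // i ≠ m} → SignType := fun i =>
    if stdVec i.1 ∈ T then 1 else if -stdVec i.1 ∈ T then -1 else 0
  have hσ1 : ∀ i, σ i = 1 ↔ stdVec i.1 ∈ T := by
    intro i
    simp only [σ]
    split_ifs with h1 h2 <;> simp [h1]
  have hσ2 : ∀ i, σ i = -1 ↔ -stdVec i.1 ∈ T := by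
    intro i
    simp only [σ]
    split_ifs with h1 h2
    · simpa using hanti i h1
    · simp [h2]
    · simp [h2]
  have hTS : T ⊆ signVertices m σ := by
    intro v hv
    obtain ⟨i, hi⟩ := hv.1
    by_cases him : i = m
    · exact Or.inl (him ▸ hi)
    · rcases hi with rfl | rfl
      · exact (stdVec_mem_signVertices ⟨i, him⟩).2 ((hσ1 ⟨i, him⟩).2 hv)
      · exact (neg_stdVec_mem_signVertices ⟨i, him⟩).2 ((hσ2 ⟨i, him⟩).2 hv)
  -- The vertices `± eₘ` enter as the extremes of `φ`, so no steep supporting slope has to be found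
  -- for them.
  have hS' : ∀ v ∈ signVertices m σ, v ∈ T ∨ (∀ u ∈ crossVertices n, φ v ≤ φ u) ∨
      ∀ u ∈ crossVertices n, φ u ≤ φ v := by
    rintro v (h | ⟨i, ⟨h, rfl⟩ | ⟨h, rfl⟩⟩)
    · rcases (hiff v).2 h with rfl | rfl
      · exact Or.inr (Or.inr fun u hu => htop ▸ (abs_le.1 (abs_le_dominant hm hu)).2)
      · refine Or.inr (Or.inl fun u hu => ?_)
        rw [map_neg, htop]
        exact (abs_le.1 (abs_le_dominant hm hu)).1
    · exact Or.inl ((hσ1 i).1 h)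
    · exact Or.inl ((hσ2 i).1 h)
  refine ⟨σ, fun hσ => ?_, fun p q hpq => ?_⟩
  · obtain ⟨r, hr, hr1, hr2⟩ := exists_mem_upperHull (top := top) (finite_crossVertices n)
      (fun v hv => neg_mem_crossVertices hv) h0' hne
    rcases hTS hr with h | ⟨i, ⟨h, -⟩ | ⟨h, -⟩⟩
    · rcases (hiff r).2 h with h | h
      · exact hr1 h
      · exact hr2 h
    · simp [hσ] at h
    · simp [hσ] at h
  · obtain ⟨hp, hq, hlt, hcons⟩ := pairwise_consecutive (pairwise_signPath φ m σ) hpq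
    simp only [mem_signPath hinj] at hp hq hcons
    exact upperHull_dominates (finite_crossVertices n) hinj hTS (signVertices_subset m σ) hS'
      hp hq hlt hcons

end CrossPolytopePaths

/-! ### Vertices of the monotone path polytope -/

section Vertices

variable {n : ℕ} {φ : (Fin n → ℝ) →ₗ[ℝ] ℝ} {m : Fin n}

theorem exists_signPath_integral_ge (hn : 2 ≤ n) (hinj : Set.InjOn φ (crossVertices n))
    (hm : ∀ i, i ≠ m → |φ (stdVec i)| < |φ (stdVec m)|)
    {γ : ({i : Fin n // i ≠ m} → SignType) → ℝ → Fin n → ℝ}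
    (hγ : ∀ σ, Traverses φ (crossPolytope n) (γ σ) (signPath φ m σ))
    (ψ : (Fin n → ℝ) →L[ℝ] ℝ) : ∃ σ : {i : Fin n // i ≠ m} → SignType, σ ≠ 0 ∧
      ∀ s, IsSection φ (crossPolytope n) s →
        ψ (∫ x in φ '' crossPolytope n, s x) ≤ ψ (∫ x in φ '' crossPolytope n, γ σ x) := by
  obtain ⟨σ, hσ, h⟩ := exists_signPath_dominating hn hinj hm ψ.toLinearMap
  exact ⟨σ, hσ, fun s hs => integral_section_le (image_crossPolytope hm) hs (hγ σ).1 ψ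
    (le_of_traverses (hγ σ) hs ψ.toLinearMap h)⟩

theorem signPath_strict (hinj : Set.InjOn φ (crossVertices n))
    (hm : ∀ i, i ≠ m → |φ (stdVec i)| < |φ (stdVec m)|)
    {σ : {i : Fin n // i ≠ m} → SignType} (hσ : σ ≠ 0) {γ : ℝ → Fin n → ℝ}
    (hγ : Traverses φ (crossPolytope n) γ (signPath φ m σ)) :
    ∃ ψ : (Fin n → ℝ) →L[ℝ] ℝ, ∀ s, IsSection φ (crossPolytope n) s →
      ψ (∫ x in φ '' crossPolytope n, s x) ≤ ψ (∫ x in φ '' crossPolytope n, γ x) ∧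
      (ψ (∫ x in φ '' crossPolytope n, s x) = ψ (∫ x in φ '' crossPolytope n, γ x) →
        ∀ x ∈ φ '' crossPolytope n, s x = γ x) := by
  have hV : ∀ v ∈ signPath φ m σ, v ∈ crossVertices n := fun v hv =>
    signVertices_subset m σ ((mem_signPath hinj).1 hv)
  refine ⟨(signFunctional φ m σ).toContinuousLinearMap, fun s hs => ?_⟩
  have hle := le_of_traverses hγ hs (signFunctional φ m σ) fun p q hpq => by
    obtain ⟨-, α, β, h1, h2⟩ := signPath_supported hinj hm hσ hpq
    exact ⟨α, β, h1, (h2 p (hV p (hpq.subset (by simp)))).2 (Or.inl rfl),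
      (h2 q (hV q (hpq.subset (by simp)))).2 (Or.inr rfl)⟩
  refine ⟨integral_section_le (image_crossPolytope hm) hs hγ.1 _ hle, fun e x hx => ?_⟩
  have hlt : -|φ (stdVec m)| < |φ (stdVec m)| := by
    have := dominant_pos (m := m) hinj
    linarith
  exact eq_of_traverses hγ hs (signFunctional φ m σ)
    (fun p q hpq => signPath_supported hinj hm hσ hpq) hV x hx
    (eqOn_of_integral_section_eq hlt (image_crossPolytope hm) hs hγ.1
      (signFunctional φ m σ).toContinuousLinearMap hle e x hx)

/-- Strictness forces the section along `L` to agree with `γ`, so both paths cover the same set. The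
extreme points in that set are the vertices of either path, and `φ` orders them. -/
theorem eq_signPath_of_integral_eq (hinj : Set.InjOn φ (crossVertices n))
    (hm : ∀ i, i ≠ m → |φ (stdVec i)| < |φ (stdVec m)|)
    {σ : {i : Fin n // i ≠ m} → SignType} (hσ : σ ≠ 0) {γ : ℝ → Fin n → ℝ}
    (hγ : Traverses φ (crossPolytope n) γ (signPath φ m σ)) {L : List (Fin n → ℝ)}
    (hL : IsMonotonePathWithIntegral φ (crossPolytope n) L
      (∫ x in φ '' crossPolytope n, γ x)) : L = signPath φ m σ := by
  obtain ⟨hmono, s, hs, e⟩ := hL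
  obtain ⟨ψ, hψ⟩ := signPath_strict hinj hm hσ hγ
  have hEq := (hψ s hs.1).2 (by rw [e])
  have himage := (Set.image_congr hEq).symm.trans hs.2
  rw [hγ.2] at himage
  have hne : {x | ∃ p q, [p, q] <:+: signPath φ m σ ∧ x ∈ segment ℝ p q}.Nonempty := by
    rw [← hγ.2, image_crossPolytope hm]
    exact (Set.nonempty_Icc.2 (by linarith [abs_nonneg (φ (stdVec m))])).image _
  have hpw : L.Pairwise (φ · < φ ·) := by
    have : L.IsChain (φ · < φ ·) := hmono.edges.imp fun _ _ h => h.1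
    rw [← List.isChain_map (R := (· < ·)) φ] at this
    exact List.pairwise_map.1 this.pairwise
  refine eq_of_pairwise_of_mem_iff hpw (pairwise_signPath φ m σ) fun v => ?_
  rw [mem_iff_mem_segments hmono.vertices (himage ▸ hne) v, mem_iff_mem_segments
    (isMonotonePath_signPath hinj hm hσ).vertices hne v]
  have := Set.ext_iff.1 himage v
  simp only [Set.mem_ofPred_eq] at this
  rw [this]

theorem signPath_injective (hinj : Set.InjOn φ (crossVertices n))
    {σ τ : {i : Fin n // i ≠ m} → SignType} (h : signPath φ m σ = signPath φ m τ) : σ = τ := by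
  have key : ∀ v, v ∈ signVertices m σ ↔ v ∈ signVertices m τ := fun v => by
    rw [← mem_signPath hinj, h, mem_signPath hinj]
  funext i
  have h1 := key (stdVec i.1)
  have h2 := key (-stdVec i.1)
  rw [stdVec_mem_signVertices, stdVec_mem_signVertices] at h1
  rw [neg_stdVec_mem_signVertices, neg_stdVec_mem_signVertices] at h2
  revert h1 h2
  generalize σ i = a
  generalize τ i = b
  revert a b
  decide

/-- The vertices of the monotone path polytope are the integrals of the paths of the nonzero sign
vectors. -/
theorem extremePoints_monotonePathPolytope (hn : 2 ≤ n) (hinj : Set.InjOn φ (crossVertices n))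
    (hm : ∀ i, i ≠ m → |φ (stdVec i)| < |φ (stdVec m)|)
    {γ : ({i : Fin n // i ≠ m} → SignType) → ℝ → Fin n → ℝ}
    (hγ : ∀ σ, Traverses φ (crossPolytope n) (γ σ) (signPath φ m σ)) :
    (monotonePathPolytope φ (crossPolytope n)).extremePoints ℝ =
      {v | ∃ σ, σ ≠ 0 ∧ ∫ x in φ '' crossPolytope n, γ σ x = v} := by
  set F := {v | ∃ σ, σ ≠ 0 ∧ ∫ x in φ '' crossPolytope n, γ σ x = v} with hF
  have hfin : F.Finite :=
    (Set.finite_range fun σ => ∫ x in φ '' crossPolytope n, γ σ x).subset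
      fun v ⟨σ, _, h⟩ => ⟨σ, h⟩
  have hFG : F ⊆ {y | ∃ s, IsSection φ (crossPolytope n) s ∧
      y = ∫ x in φ '' crossPolytope n, s x} := by
    rintro v ⟨σ, -, rfl⟩
    exact ⟨γ σ, (hγ σ).1, rfl⟩
  have heq : monotonePathPolytope φ (crossPolytope n) = convexHull ℝ F := by
    apply Set.Subset.antisymm
    · refine convexHull_min ?_ (convex_convexHull ℝ F)
      rintro y ⟨s, hs, rfl⟩
      -- A functional separating the integral of `s` strictly from the hull of `F` would be at least
      -- as large at the integral of some sign path, which lies in `F`.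
      by_contra hy
      obtain ⟨ψ, u, h1, h2⟩ := geometric_hahn_banach_closed_point (convex_convexHull ℝ F)
        (hfin.isClosed_convexHull ℝ) hy
      obtain ⟨σ, hσ, h⟩ := exists_signPath_integral_ge hn hinj hm hγ ψ
      have h3 := h1 _ (subset_convexHull ℝ F ⟨σ, hσ, rfl⟩)
      have h4 := h s hs
      linarith
    · exact convexHull_mono hFG
  apply Set.Subset.antisymm
  · rw [heq]
    exact extremePoints_convexHull_subset
  · rintro v ⟨σ, hσ, rfl⟩
    obtain ⟨ψ, hψ⟩ := signPath_strict hinj hm hσ (hγ σ)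
    rw [← isExtreme_singleton, ← convexHull_singleton (𝕜 := ℝ), monotonePathPolytope]
    refine isExtreme_convexHull_maximizers ψ.toLinearMap
      (c := ψ (∫ x in φ '' crossPolytope n, γ σ x)) ?_ ?_ ?_
    · rintro _ ⟨s, hs, rfl⟩
      exact (hψ s hs).1
    · rintro _ rfl
      exact ⟨γ σ, (hγ σ).1, rfl⟩
    · rintro _ ⟨s, hs, rfl⟩
      refine ⟨fun e => ?_, fun e => by rw [Set.mem_singleton_iff.1 e]; rfl⟩
      refine MeasureTheory.setIntegral_congr_fun ?_ ((hψ s hs).2 e)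
      rw [image_crossPolytope hm]
      exact measurableSet_Icc

theorem card_nonzero_signs (m : Fin n) :
    Nat.card {σ : {i : Fin n // i ≠ m} → SignType // σ ≠ 0} = 3 ^ (n - 1) - 1 := by
  have : Fintype.card SignType = 3 := rfl
  simp [Nat.card_eq_fintype_card, Fintype.card_subtype_compl, this]

end Vertices

theorem mainTheorem4 (n : ℕ) (hn : 2 ≤ n) (φ : (Fin n → ℝ) →ₗ[ℝ] ℝ)
    (hφ : IsVertexGeneric φ (crossPolytope n)) :
    ((monotonePathPolytope φ (crossPolytope n)).extremePoints ℝ).ncard = 3 ^ (n - 1) - 1 ∧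
    ∃ m : Fin n, (∀ i, i ≠ m → |φ (stdVec i)| < |φ (stdVec m)|) ∧
      ∃ B : ((monotonePathPolytope φ (crossPolytope n)).extremePoints ℝ) ≃
          {σ : {i : Fin n // i ≠ m} → SignType // σ ≠ 0},
        ∀ v : ((monotonePathPolytope φ (crossPolytope n)).extremePoints ℝ),
          (∃! L : List (Fin n → ℝ), IsMonotonePathWithIntegral φ (crossPolytope n) L v) ∧
          ∀ L : List (Fin n → ℝ), IsMonotonePathWithIntegral φ (crossPolytope n) L v →
            ∀ i : {i : Fin n // i ≠ m},
              ((B v).1 i = 1 ↔ stdVec i.1 ∈ L) ∧ ((B v).1 i = -1 ↔ -stdVec i.1 ∈ L) := by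
  have hinj : Set.InjOn φ (crossVertices n) := by
    rwa [IsVertexGeneric, extremePoints_crossPolytope] at hφ
  obtain ⟨m, hm⟩ := exists_dominant_index hn hinj
  choose γ hγ using exists_traverses_signPath hinj hm
  have hext := extremePoints_monotonePathPolytope hn hinj hm hγ
  have hpath : ∀ σ, σ ≠ 0 → IsMonotonePathWithIntegral φ (crossPolytope n) (signPath φ m σ)
      (∫ x in φ '' crossPolytope n, γ σ x) := fun σ hσ =>
    ⟨isMonotonePath_signPath hinj hm hσ, γ σ, hγ σ, rfl⟩
  let f : {σ : {i : Fin n // i ≠ m} → SignType // σ ≠ 0} →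
      (monotonePathPolytope φ (crossPolytope n)).extremePoints ℝ :=
    fun σ => ⟨∫ x in φ '' crossPolytope n, γ σ.1 x, hext ▸ ⟨σ.1, σ.2, rfl⟩⟩
  have hf : Function.Bijective f := by
    constructor
    · intro σ τ h
      have e : ∫ x in φ '' crossPolytope n, γ σ.1 x = ∫ x in φ '' crossPolytope n, γ τ.1 x :=
        congrArg Subtype.val h
      -- The path of `σ` has the same integral as that of `τ`, so uniqueness identifies the two
      -- paths.
      exact Subtype.ext (signPath_injective hinj
        (eq_signPath_of_integral_eq hinj hm τ.2 (hγ τ.1) (e ▸ hpath σ.1 σ.2)))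
    · rintro ⟨v, hv⟩
      obtain ⟨σ, hσ, h⟩ := hext ▸ hv
      exact ⟨⟨σ, hσ⟩, Subtype.ext h⟩
  let e := Equiv.ofBijective f hf
  refine ⟨?_, m, hm, e.symm, fun v => ?_⟩
  · rw [← card_nonzero_signs m, Nat.card_congr e]
    rfl
  · obtain ⟨σ, rfl⟩ := e.surjective v
    rw [Equiv.symm_apply_apply]
    have huniq : ∀ L, IsMonotonePathWithIntegral φ (crossPolytope n) L (e σ) →
        L = signPath φ m σ.1 := fun L hL =>
      eq_signPath_of_integral_eq hinj hm σ.2 (hγ σ.1) hL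
    refine ⟨⟨signPath φ m σ.1, hpath σ.1 σ.2, huniq⟩, fun L hL i => ?_⟩
    rw [huniq L hL, mem_signPath hinj, mem_signPath hinj, stdVec_mem_signVertices,
      neg_stdVec_mem_signVertices]
    exact ⟨Iff.rfl, Iff.rfl⟩
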